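/- A signed hypergraph $H=(V,S)$ consists of a finite node set $V$ and a finite set $S$ of signed edges; a signed edge $s=(e,\eta_s)$ is a set $e\subseteq V$ with $|e|\ge 2$ together with signs $\eta_s(v)\in\{-1,+1\}$, $v\in e$ (we write $v\in s$, $|s|$, $s\subseteq U$ for $v\in e$, $|e|$, $e\subseteq U$). For $v\in s$ put $\sigma_s(z_v)=z_v$ if $\eta_s(v)=+1$ and $\sigma_s(z_v)=1-z_v$ if $\eta_s(v)=-1$. The pseudo-Boolean polytope of $H$ is $$\mathrm{PBP}(H)=\mathrm{conv}\Big\{z\in\{0,1\}^{V\cup S}: z_s=\prod_{v\in s}\sigma_s(z_v)\ \ \forall s\in S\Big\}.$$ An extended formulation of $\mathrm{PBP}(H)$ is a finite system of linear inequalities in the variables $z\in\mathbb R^{V\cup S}$ and finitely many additional variables $y$ such that $\mathrm{PBP}(H)$ is the projection of its solution set onto the $z$-space; all variables $(z,y)$ are counted, and an equality counts as two inequalities. Let $k_1,k_2\ge 0$ be integers and let $S=S_1\cup S_2$, where each $s\in S_1$ contains at least $|V|-k_1$ nodes, and each $s\in S_2$ is contained in a fixed set $U\subseteq V$ with $|U|=k_2$.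 1. If $S\neq\emptyset$, then $\mathrm{PBP}(H)$ has an extended formulation with $O(2^{\max\{k_1,k_2\}}|S||V|)$ variables and inequalities, all of whose coefficients and right-hand side constants are $0,\pm1$. The constant in $O(\cdot)$ is absolute. 2. In particular, if $\max\{k_1,k_2\}=O(\log\mathrm{poly}(|V|,|S|))$, then $\mathrm{PBP}(H)$ has a polynomial-size extended formulation with coefficients and right-hand side constants $0,\pm1$. That is, for every constant $c\ge0$ and every real polynomial $p$ in two variables there is a real polynomial $r$ in two variables such that, for all $H,k_1,k_2$ as above with $p(|V|,|S|)>0$ and $\max\{k_1,k_2\}\le c\log p(|V|,|S|)$, the polytope $\mathrm{PBP}(H)$ has such an extended formulation with at most $r(|V|,|S|)$ variables and at most $r(|V|,|S|)$ inequalities. -/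

import Mathlib

universe u

/-- A signed edge on the node set `V`: a set `e` of at least two nodes together with a map
assigning to each `v ∈ e` a sign in `{-1, +1}` (the units of `ℤ`). -/
@[ext]
structure SignedEdge (V : Type u) where
  /-- the underlying edge -/
  support : Finset V
  two_le_card : 2 ≤ support.card
  /-- the sign map, defined on the nodes of the underlying edge only -/
  sign : {v // v ∈ support} → ℤˣ

/-- A signed hypergraph with (finite) node set `V`. Since the signed edges form a set, no two of
them are identical; parallel signed edges (same underlying edge, different signs) are allowed. -/
structure SignedHypergraph (V : Type u) where
  edges : Finset (SignedEdge V)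

/-- `σ_s(t)` at the node `v ∈ s`: it is `t` if `v` has sign `+1` in `s`, and `1 - t` otherwise. -/
noncomputable def SignedEdge.sigma {V : Type u} (s : SignedEdge V) (v : {v // v ∈ s.support})
    (t : ℝ) : ℝ :=
  if s.sign v = 1 then t else 1 - t

namespace SignedHypergraph

/-- The coordinates of `ℝ^{V ∪ S}`: one for each node and one for each signed edge. -/
abbrev Coord {V : Type u} (H : SignedHypergraph V) : Type u :=
  V ⊕ {s // s ∈ H.edges}

/-- The pseudo-Boolean set: the binary points `z` with `z_s = ∏_{v ∈ s} σ_s(z_v)` for every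
signed edge `s`. -/
def PBS {V : Type u} (H : SignedHypergraph V) : Set (H.Coord → ℝ) :=
  {z | (∀ i, z i = 0 ∨ z i = 1) ∧
    ∀ s : {s // s ∈ H.edges},
      z (Sum.inr s) = ∏ v : {v // v ∈ s.1.support}, s.1.sigma v (z (Sum.inl v.1))}

/-- The pseudo-Boolean polytope: the convex hull of the pseudo-Boolean set. -/
def PBP {V : Type u} (H : SignedHypergraph V) : Set (H.Coord → ℝ) :=
  convexHull ℝ H.PBS

/-- The signed edges split (possibly with overlap) into a family `S₁`, each of whose members
contains at least `|V| - k₁` nodes, and a family `S₂`, all of whose members are contained in one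
set `U` of exactly `k₂` nodes. -/
def TwoFamilies {V : Type u} [Fintype V] (H : SignedHypergraph V) (k₁ k₂ : ℕ) : Prop :=
  ∃ (S₁ S₂ : Set (SignedEdge V)) (U : Finset V),
    (H.edges : Set (SignedEdge V)) = S₁ ∪ S₂ ∧
    (∀ s ∈ S₁, (Fintype.card V : ℤ) - k₁ ≤ s.support.card) ∧
    U.card = k₂ ∧
    ∀ s ∈ S₂, s.support ⊆ U

end SignedHypergraph

/-- A finite system of linear inequalities `A (x, y) ≤ b` in the variables `x ∈ ℝ^ι` and
additional variables `y ∈ ℝ^q`. (An equality constraint is written as two inequalities.) -/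
structure LiftedSystem (ι : Type u) where
  /-- number of additional variables -/
  q : ℕ
  /-- number of inequalities -/
  m : ℕ
  A : Matrix (Fin m) (ι ⊕ Fin q) ℝ
  b : Fin m → ℝ

namespace LiftedSystem

/-- The system is an extended formulation of `P`: the projection of its solution set onto the
`x`-space is `P`. -/
def IsExtendedFormulation {ι : Type u} [Fintype ι] (L : LiftedSystem ι) (P : Set (ι → ℝ)) : Prop :=
  {x : ι → ℝ | ∃ y : Fin L.q → ℝ, ∀ i, L.A.mulVec (Sum.elim x y) i ≤ L.b i} = P

/-- The number of all variables, original and additional. -/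
def numVars {ι : Type u} [Fintype ι] (L : LiftedSystem ι) : ℕ :=
  Fintype.card ι + L.q

/-- The number of inequalities. -/
def numIneqs {ι : Type u} (L : LiftedSystem ι) : ℕ :=
  L.m

/-- All coefficients and right-hand side constants are `0`, `1` or `-1`. -/
def HasUnitData {ι : Type u} (L : LiftedSystem ι) : Prop :=
  (∀ i j, L.A i j ∈ ({0, 1, -1} : Set ℝ)) ∧ ∀ i, L.b i ∈ ({0, 1, -1} : Set ℝ)

end LiftedSystem

/-!
The polytope is written as the projection of a flow polytope. Read a `0/1` point of `V` coordinate
by coordinate with a layered branching program, that is, a finite automaton whose transitions may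
depend on the position. If its final state determines the value of every signed edge, then a point
of the pseudo-Boolean set is the same as a path through the layered graph of the program: its node
coordinates are read off from the labels of the arcs used, its edge coordinates from the final
node. Unit flows through the graph are mixtures of paths (`IsFlow.exists_distribution`: a flow is a
Markov chain), so the unit flows form an extended formulation whose size is proportional to `|V|`
times the number of states (`exists_extendedFormulation_of_program`). Flow conservation and the two
read-off rules only involve the coefficients `0, 1, -1`.

It remains to find a program with few states. Let `T` be the set of points at which some edge of
the first family takes the value `1`. Such an edge fixes all but `k₁` coordinates, so
`|T| ≤ 2 ^ k₁ * |S|`. The program remembers the coordinates in `U` and whether the coordinates read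
so far agree with a member of `T`; in the latter case that member already records everything, so
`2 ^ k₂ + |T|` states suffice (`exists_run_eq`). In the end the point is known if it lies in `T`.
Otherwise all edges of the first family vanish, and those of the second are determined by the
coordinates in `U`.

When `max k₁ k₂ ≤ c * log p`, the factor `2 ^ max k₁ k₂` is at most `p ^ c`, hence at most the
polynomial `(1 + p ^ 2) ^ ⌈c⌉`.
-/

/-! ### Branching programs and unit flows -/

/-- A layered read-once branching program with state set `Q` on words of `n` bits: it begins in
`start`, and reading the bit `b` at position `i` in state `q` leads to the state `step i q b`. -/
structure BranchingProgram (n : ℕ) (Q : Type*) where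
  start : Q
  step : Fin n → Q → Bool → Q

namespace BranchingProgram

variable {n : ℕ} {Q : Type*}

/-- The state of the program after it has read the first `k` bits of the word `x`. -/
def run (P : BranchingProgram n Q) (x : Fin n → Bool) (k : Fin (n + 1)) : Q :=
  Fin.induction (motive := fun _ => Q) P.start (fun i q => P.step i q (x i)) k

@[simp]
theorem run_zero (P : BranchingProgram n Q) (x : Fin n → Bool) : P.run x 0 = P.start := rfl

theorem run_succ (P : BranchingProgram n Q) (x : Fin n → Bool) (i : Fin n) :
    P.run x i.succ = P.step i (P.run x i.castSucc) (x i) := by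
  simp [run, Fin.induction_succ]

theorem run_update_of_le (P : BranchingProgram n Q) (x : Fin n → Bool) (i : Fin n) (b : Bool)
    (k : Fin (n + 1)) (hk : k ≤ i.castSucc) : P.run (Function.update x i b) k = P.run x k := by
  induction k using Fin.induction with
  | zero => simp
  | succ j ih =>
    have hj : j.castSucc < i.castSucc := lt_of_lt_of_le j.castSucc_lt_succ hk
    have hne : j ≠ i := fun h => by simp [h] at hj
    rw [run_succ, run_succ, ih hj.le, Function.update_of_ne hne]

open scoped Classical in
/-- A unit flow through the layered graph of the program: `g k q` is the flow through the node
`q` of layer `k`, and `f i q b` the flow on the arc from `q` that is labelled by the value `b` of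
bit `i`. -/
structure IsFlow [Fintype Q] (P : BranchingProgram n Q) (g : Fin (n + 1) → Q → ℝ)
    (f : Fin n → Q → Bool → ℝ) : Prop where
  node_nonneg : ∀ k q, 0 ≤ g k q
  arc_nonneg : ∀ i q b, 0 ≤ f i q b
  start : ∀ q, g 0 q = if q = P.start then 1 else 0
  out : ∀ i q, g i.castSucc q = ∑ b, f i q b
  into : ∀ i q, g i.succ q = ∑ q', ∑ b, if P.step i q' b = q then f i q' b else 0

open scoped Classical in
/-- The unit flow that follows the computation on a single word. -/
theorem isFlow_run [Fintype Q] (P : BranchingProgram n Q) (x : Fin n → Bool) :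
    P.IsFlow (fun k q => if P.run x k = q then 1 else 0)
      (fun i q b => if P.run x i.castSucc = q ∧ x i = b then 1 else 0) where
  node_nonneg k q := by split_ifs <;> norm_num
  arc_nonneg i q b := by split_ifs <;> norm_num
  start q := by simp [eq_comm]
  out i q := by simp [ite_and]
  into i q := by
    simp only [ite_and, run_succ]
    rw [Finset.sum_eq_single (P.run x i.castSucc)]
    · rw [Finset.sum_eq_single (x i)]
      · simp
      · intro b _ hb
        simp [hb.symm]
      · simp
    · intro q' _ hq'
      simp [hq'.symm]
    · simp

open scoped Classical in
/-- Every unit flow is a mixture of computations. The random word is drawn bit by bit: in state `q`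
of layer `i` the next bit is `b` with probability `f i q b / g i.castSucc q`. -/
theorem IsFlow.exists_distribution [Fintype Q] {P : BranchingProgram n Q}
    {g : Fin (n + 1) → Q → ℝ} {f : Fin n → Q → Bool → ℝ} (h : P.IsFlow g f) :
    ∃ (Ω : Type) (_ : Fintype Ω) (w : Ω → ℝ) (X : Ω → Fin n → Bool),
      (∀ ω, 0 ≤ w ω) ∧ ∑ ω, w ω = 1 ∧
      (∀ i, ∑ ω, (if X ω i = true then w ω else 0) = ∑ q, f i q true) ∧
      ∀ q, ∑ ω, (if P.run (X ω) (Fin.last n) = q then w ω else 0) = g (Fin.last n) q := by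
  -- at stage `k` the words of `X` have been drawn up to position `k`; later bits are irrelevant
  suffices H : ∀ k : Fin (n + 1),
      ∃ (Ω : Type) (_ : Fintype Ω) (w : Ω → ℝ) (X : Ω → Fin n → Bool),
        (∀ ω, 0 ≤ w ω) ∧ ∑ ω, w ω = 1 ∧
        (∀ i : Fin n, i.castSucc < k →
          ∑ ω, (if X ω i = true then w ω else 0) = ∑ q, f i q true) ∧
        ∀ q, ∑ ω, (if P.run (X ω) k = q then w ω else 0) = g k q by
    obtain ⟨Ω, _, w, X, h₁, h₂, h₃, h₄⟩ := H (Fin.last n)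
    exact ⟨Ω, _, w, X, h₁, h₂, fun i => h₃ i i.castSucc_lt_last, h₄⟩
  intro k
  induction k using Fin.induction with
  | zero =>
    refine ⟨Unit, inferInstance, fun _ => 1, fun _ _ => false, by simp, by simp, ?_, ?_⟩
    · intro i hi
      exact absurd hi (Fin.not_lt_zero _)
    · intro q
      simp [h.start, eq_comm]
  | succ k ih =>
    obtain ⟨Ω, _, w, X, hw, hw1, hX, hg⟩ := ih
    -- where the node flow `g` vanishes the quotient below is `0`, and so is the weight `w`
    have hw0 : ∀ ω, g k.castSucc (P.run (X ω) k.castSucc) = 0 → w ω = 0 := by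
      intro ω h0
      rw [← hg, Finset.sum_eq_zero_iff_of_nonneg
        (fun ω _ => by split_ifs; exacts [hw ω, le_rfl])] at h0
      simpa using h0 ω (Finset.mem_univ _)
    let p : Ω → Bool → ℝ := fun ω b =>
      w ω * (f k (P.run (X ω) k.castSucc) b / g k.castSucc (P.run (X ω) k.castSucc))
    have hp : ∀ ω, ∑ b, p ω b = w ω := by
      intro ω
      rw [← Finset.mul_sum, ← Finset.sum_div, ← h.out]
      by_cases h0 : g k.castSucc (P.run (X ω) k.castSucc) = 0
      · simp [hw0 ω h0]
      · rw [div_self h0, mul_one]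
    have hfib : ∀ q b, ∑ ω, (if P.run (X ω) k.castSucc = q then p ω b else 0) = f k q b := by
      intro q b
      have : ∀ ω, (if P.run (X ω) k.castSucc = q then p ω b else 0) =
          (if P.run (X ω) k.castSucc = q then w ω else 0) * (f k q b / g k.castSucc q) := by
        intro ω
        split_ifs with hq
        · simp [p, hq]
        · simp
      rw [Finset.sum_congr rfl fun ω _ => this ω, ← Finset.sum_mul, hg]
      by_cases h0 : g k.castSucc q = 0
      · have h1 := h0
        rw [h.out, Finset.sum_eq_zero_iff_of_nonneg (fun b _ => h.arc_nonneg k q b)] at h1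
        simp [h0, h1 b (Finset.mem_univ _)]
      · field_simp
    have htot : ∀ b, ∑ ω, p ω b = ∑ q, f k q b := by
      intro b
      simp only [← hfib]
      rw [Finset.sum_comm]
      simp
    refine ⟨Ω × Bool, inferInstance, fun z => p z.1 z.2,
      fun z => Function.update (X z.1) k z.2, ?_, ?_, ?_, ?_⟩
    · rintro ⟨ω, b⟩
      exact mul_nonneg (hw ω) (div_nonneg (h.arc_nonneg _ _ _) (h.node_nonneg _ _))
    · rw [Fintype.sum_prod_type]
      simp only [hp, hw1]
    · intro i hi
      rw [Fintype.sum_prod_type]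
      rcases eq_or_ne i k with rfl | hne
      · simp [htot]
      · have hlt : i.castSucc < k.castSucc := by
          refine lt_of_le_of_ne (Fin.le_castSucc_iff.2 hi) fun h => hne ?_
          exact Fin.castSucc_injective _ h
        rw [← hX i hlt]
        refine Finset.sum_congr rfl fun ω _ => ?_
        simp only [Function.update_of_ne hne]
        split_ifs
        · exact hp ω
        · simp
    · intro q
      rw [h.into, Fintype.sum_prod_type]
      simp only [run_succ, Function.update_self, P.run_update_of_le _ k _ _ le_rfl, ← hfib]
      rw [Finset.sum_comm, Finset.sum_comm (s := (Finset.univ : Finset Q))]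
      refine Finset.sum_congr rfl fun b _ => ?_
      have : ∀ q', (if P.step k q' b = q then
          ∑ ω, (if P.run (X ω) k.castSucc = q' then p ω b else 0) else 0) =
          ∑ ω, (if P.run (X ω) k.castSucc = q' then
            (if P.step k q' b = q then p ω b else 0) else 0) := by
        intro q'
        split_ifs <;> simp
      rw [Finset.sum_congr rfl fun q' _ => this q', Finset.sum_comm]
      simp

open scoped Classical in
/-- A finite set `T` of words can be recognised, and the bits at a set `U` of positions remembered,
with `2 ^ |U| + |T|` states: a state `inr t` means that the bits read so far agree with `t ∈ T`,
while `inl u` means that they agree with no member of `T` and that `u` records those in `U`. -/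
theorem exists_run_eq (T : Finset (Fin n → Bool)) (U : Finset (Fin n)) :
    ∃ P : BranchingProgram n ((U → Bool) ⊕ T), ∀ x : Fin n → Bool,
      (∃ t : T, P.run x (Fin.last n) = Sum.inr t ∧ t.1 = x) ∨
      (∃ u : U → Bool, P.run x (Fin.last n) = Sum.inl u ∧ x ∉ T ∧ ∀ i : U, u i = x i) := by
  -- the state after `k` bits of `x`, with an arbitrary choice among the members of `T` that agree
  let branch : (k : Fin (n + 1)) → (Fin n → Bool) → ((U → Bool) ⊕ T) := fun k x =>
    if h : ∃ t : T, ∀ i : Fin n, i.castSucc < k → t.1 i = x i then Sum.inr h.choose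
    else Sum.inl fun i => x i
  let P : BranchingProgram n ((U → Bool) ⊕ T) :=
    { -- nothing has been read yet, so any word may be used here
      start := branch 0 fun _ => false
      -- the stored `t` agrees with all bits read so far, so it stands in for the word
      step := fun i q b => q.elim (fun u => Sum.inl fun j => if j.1 = i then b else u j)
        (fun t => branch i.succ (Function.update t.1 i b)) }
  have hlt : ∀ {i k : Fin n}, i.castSucc < k.succ → i ≠ k → i.castSucc < k.castSucc := by
    intro i k hi hne
    exact lt_of_le_of_ne (Fin.le_castSucc_iff.2 hi) fun h => hne (Fin.castSucc_injective _ h)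
  -- `branch` only looks at the bits below `k`
  have hbranch : ∀ (k : Fin (n + 1)) (x y : Fin n → Bool),
      (∀ i : Fin n, i.castSucc < k → y i = x i) →
      (∃ t : T, branch k y = Sum.inr t ∧ ∀ i : Fin n, i.castSucc < k → t.1 i = x i) ∨
      (∃ u : U → Bool, branch k y = Sum.inl u ∧
        (∀ t ∈ T, ∃ i : Fin n, i.castSucc < k ∧ t i ≠ x i) ∧
        ∀ i : U, i.1.castSucc < k → u i = x i) := by
    intro k x y hxy
    by_cases h : ∃ t : T, ∀ i : Fin n, i.castSucc < k → t.1 i = y i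
    · left
      refine ⟨h.choose, dif_pos h, fun i hi => ?_⟩
      rw [← hxy i hi]
      exact h.choose_spec i hi
    · right
      refine ⟨fun i => y i, dif_neg h, fun t ht => ?_, fun i hi => hxy i hi⟩
      push Not at h
      obtain ⟨i, hi, hne⟩ := h ⟨t, ht⟩
      exact ⟨i, hi, hxy i hi ▸ hne⟩
  refine ⟨P, fun x => ?_⟩
  have key : ∀ k : Fin (n + 1),
      (∃ t : T, P.run x k = Sum.inr t ∧ ∀ i : Fin n, i.castSucc < k → t.1 i = x i) ∨
      (∃ u : U → Bool, P.run x k = Sum.inl u ∧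
        (∀ t ∈ T, ∃ i : Fin n, i.castSucc < k ∧ t i ≠ x i) ∧
        ∀ i : U, i.1.castSucc < k → u i = x i) := by
    intro k
    induction k using Fin.induction with
    | zero => exact hbranch 0 x _ fun i hi => absurd hi (Fin.not_lt_zero _)
    | succ k ih =>
      rw [run_succ]
      rcases ih with ⟨t, ht, htx⟩ | ⟨u, hu, hT, hux⟩
      · rw [ht]
        refine hbranch k.succ x _ fun i hi => ?_
        rcases eq_or_ne i k with rfl | hne
        · simp
        · rw [Function.update_of_ne hne]
          exact htx i (hlt hi hne)
      · right
        rw [hu]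
        refine ⟨_, rfl, fun t ht => ?_, fun i hi => ?_⟩
        · obtain ⟨i, hi, hne⟩ := hT t ht
          exact ⟨i, hi.trans k.castSucc_lt_succ, hne⟩
        · by_cases hik : i.1 = k
          · simp [hik]
          · simp only [hik, if_false]
            exact hux i (hlt hi hik)
  rcases key (Fin.last n) with ⟨t, ht, htx⟩ | ⟨u, hu, hT, hux⟩
  · exact Or.inl ⟨t, ht, funext fun i => htx i i.castSucc_lt_last⟩
  · refine Or.inr ⟨u, hu, fun hx => ?_, fun i => hux i i.1.castSucc_lt_last⟩
    obtain ⟨i, -, hne⟩ := hT x hx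
    exact hne rfl

end BranchingProgram

/-! ### Systems in standard form -/

namespace LiftedSystem

/-- A system in standard form, with equality constraints indexed by `E` and nonnegative additional
variables indexed by `Y`, as a system of inequalities. -/
theorem exists_of_standardForm {ι : Type u} {Y E : Type*} [Fintype ι] [Fintype Y] [Fintype E]
    (A : E → ι ⊕ Y → ℝ) (b : E → ℝ) (hA : ∀ i j, A i j ∈ ({0, 1, -1} : Set ℝ))
    (hb : ∀ i, b i ∈ ({0, 1, -1} : Set ℝ)) :
    ∃ L : LiftedSystem ι, L.q = Fintype.card Y ∧
      L.m = 2 * Fintype.card E + Fintype.card Y ∧ L.HasUnitData ∧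
      ∀ x : ι → ℝ, (∃ y : Fin L.q → ℝ, ∀ i, L.A.mulVec (Sum.elim x y) i ≤ L.b i) ↔
        ∃ y : Y → ℝ, (∀ j, 0 ≤ y j) ∧ ∀ i, ∑ j, A i j * Sum.elim x y j = b i := by
  classical
  have hneg : ∀ a : ℝ, a ∈ ({0, 1, -1} : Set ℝ) → -a ∈ ({0, 1, -1} : Set ℝ) := by
    rintro a (rfl | rfl | rfl) <;> simp
  let M : (E ⊕ E) ⊕ Y → ι ⊕ Y → ℝ := Sum.elim (Sum.elim A fun i j => -A i j)
    (fun y => Sum.elim (fun _ => 0) fun y' => if y' = y then -1 else 0)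
  let c : (E ⊕ E) ⊕ Y → ℝ := Sum.elim (Sum.elim b fun i => -b i) fun _ => 0
  have hcard : Fintype.card ((E ⊕ E) ⊕ Y) = 2 * Fintype.card E + Fintype.card Y := by
    simp [two_mul]
  let eY := Fintype.equivFin Y
  let eI := Fintype.equivFinOfCardEq hcard
  refine ⟨⟨Fintype.card Y, 2 * Fintype.card E + Fintype.card Y,
    fun i j => M (eI.symm i) (j.map id eY.symm), fun i => c (eI.symm i)⟩, rfl, rfl, ⟨?_, ?_⟩, ?_⟩
  · intro i j
    change M (eI.symm i) (j.map id eY.symm) ∈ _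
    rcases eI.symm i with (i | i) | y
    · exact hA _ _
    · exact hneg _ (hA _ _)
    · rcases j with j | j
      · simp [M]
      · simp only [M, Sum.elim_inr, Sum.map_inr]
        split_ifs <;> simp
  · intro i
    change c (eI.symm i) ∈ _
    rcases eI.symm i with (i | i) | y
    · exact hb _
    · exact hneg _ (hb _)
    · simp [c]
  · intro x
    have hsum : ∀ (y : Y → ℝ) (i : Fin (2 * Fintype.card E + Fintype.card Y)),
        Matrix.mulVec (fun i j => M (eI.symm i) (j.map id eY.symm))
          (Sum.elim x fun j => y (eY.symm j)) i = ∑ j, M (eI.symm i) j * Sum.elim x y j := by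
      intro y i
      simp only [Matrix.mulVec, dotProduct, Fintype.sum_sum_type, Sum.map_inl, Sum.map_inr,
        Sum.elim_inl, Sum.elim_inr, id]
      congr 1
      exact Equiv.sum_comp eY.symm fun j => M (eI.symm i) (Sum.inr j) * y j
    have hiff : ∀ y : Y → ℝ,
        (∀ i, Matrix.mulVec (fun i j => M (eI.symm i) (j.map id eY.symm))
          (Sum.elim x fun j => y (eY.symm j)) i ≤ c (eI.symm i)) ↔
        (∀ j, 0 ≤ y j) ∧ ∀ i, ∑ j, A i j * Sum.elim x y j = b i := by
      intro y
      simp only [hsum]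
      constructor
      · intro h
        have h' : ∀ i, ∑ j, M i j * Sum.elim x y j ≤ c i := fun i => by simpa using h (eI i)
        refine ⟨fun j => ?_, fun i => le_antisymm (h' (Sum.inl (Sum.inl i))) ?_⟩
        · have := h' (Sum.inr j)
          simpa [M, c, Fintype.sum_sum_type] using this
        · have := h' (Sum.inl (Sum.inr i))
          simp only [M, c, Sum.elim_inl, Sum.elim_inr, neg_mul, Finset.sum_neg_distrib] at this
          exact neg_le_neg_iff.1 this
      · rintro ⟨hy, hE⟩ i
        rcases eI.symm i with (i | i) | j
        · exact (hE i).le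
        · simp only [M, c, Sum.elim_inl, Sum.elim_inr, neg_mul, Finset.sum_neg_distrib]
          exact neg_le_neg (hE i).ge
        · simpa [M, c, Fintype.sum_sum_type] using hy j
    constructor
    · rintro ⟨y, hy⟩
      refine ⟨fun j => y (eY j), (hiff _).1 ?_⟩
      simpa using hy
    · rintro ⟨y, hy⟩
      exact ⟨fun j => y (eY.symm j), (hiff y).2 hy⟩

end LiftedSystem

/-! ### Vertices of the pseudo-Boolean polytope -/

namespace SignedEdge

variable {V : Type u}

/-- The product of `s` takes the value `1` at the `0/1` point `x`. -/
def Holds (s : SignedEdge V) (x : V → Bool) : Prop :=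
  ∀ v : {v // v ∈ s.support}, s.sign v = 1 ↔ x v = true

open scoped Classical in
theorem prod_sigma_eq_ite (s : SignedEdge V) (x : V → Bool) :
    ∏ v : {v // v ∈ s.support}, s.sigma v (if x v then 1 else 0) =
      if s.Holds x then 1 else 0 := by
  have h : ∀ v : {v // v ∈ s.support}, s.sigma v (if x v then 1 else 0) =
      if (s.sign v = 1 ↔ x v = true) then 1 else 0 := by
    intro v
    by_cases h₁ : s.sign v = 1 <;> by_cases h₂ : x v = true <;> simp [sigma, h₁, h₂]
  rw [Finset.prod_congr rfl fun v _ => h v, Finset.prod_boole]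
  simp [Holds]

theorem holds_congr {s : SignedEdge V} {x y : V → Bool} (h : ∀ v ∈ s.support, x v = y v) :
    s.Holds x ↔ s.Holds y :=
  forall_congr' fun v => by rw [h v v.2]

open scoped Classical in
/-- A point at which `s` holds is determined by its values outside `s`. -/
theorem card_holds_le [Fintype V] (s : SignedEdge V) {k : ℕ}
    (hk : (Fintype.card V : ℤ) - k ≤ s.support.card) :
    (Finset.univ.filter fun x : V → Bool => s.Holds x).card ≤ 2 ^ k := by
  have hinj : Set.InjOn (fun (x : V → Bool) (v : {v // v ∈ s.supportᶜ}) => x v)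
      (Finset.univ.filter fun x : V → Bool => s.Holds x) := by
    intro x hx y hy hxy
    simp only [Finset.coe_filter, Finset.mem_univ, true_and, Set.mem_ofPred_eq] at hx hy
    funext v
    by_cases hv : v ∈ s.support
    · have := (hx ⟨v, hv⟩).symm.trans (hy ⟨v, hv⟩)
      exact Bool.eq_iff_iff.2 this
    · exact congrFun hxy ⟨v, Finset.mem_compl.2 hv⟩
  calc _ ≤ (Finset.univ : Finset ({v // v ∈ s.supportᶜ} → Bool)).card :=
        Finset.card_le_card_of_injOn _ (fun _ _ => Finset.mem_coe.2 (Finset.mem_univ _)) hinj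
    _ = 2 ^ (s.supportᶜ).card := by
        rw [Finset.card_univ, Fintype.card_fun, Fintype.card_bool, Fintype.card_coe]
    _ ≤ 2 ^ k := by
        refine Nat.pow_le_pow_right two_pos ?_
        rw [Finset.card_compl]
        lia

end SignedEdge

namespace SignedHypergraph

variable {V : Type u}

open scoped Classical in
/-- The element of the pseudo-Boolean set with node values `x`. -/
noncomputable def vertex (H : SignedHypergraph V) (x : V → Bool) : H.Coord → ℝ :=
  Sum.elim (fun v => if x v then 1 else 0) fun s => if s.1.Holds x then 1 else 0

theorem vertex_mem_PBS (H : SignedHypergraph V) (x : V → Bool) : H.vertex x ∈ H.PBS := by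
  refine ⟨?_, fun s => ?_⟩
  · rintro (v | s) <;> simp only [vertex, Sum.elim_inl, Sum.elim_inr] <;> split_ifs <;> simp
  · simp only [vertex, Sum.elim_inl, Sum.elim_inr]
    exact (s.1.prod_sigma_eq_ite x).symm

theorem exists_eq_vertex (H : SignedHypergraph V) {z : H.Coord → ℝ} (hz : z ∈ H.PBS) :
    ∃ x, z = H.vertex x := by
  classical
  have hv : ∀ v, z (Sum.inl v) = if decide (z (Sum.inl v) = 1) then 1 else 0 := by
    intro v
    rcases hz.1 (Sum.inl v) with h | h <;> simp [h]
  refine ⟨fun v => decide (z (Sum.inl v) = 1), funext ?_⟩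
  rintro (v | s)
  · exact hv v
  · rw [hz.2 s, Finset.prod_congr rfl fun v _ => congrArg (s.1.sigma v) (hv v.1)]
    exact s.1.prod_sigma_eq_ite fun v => decide (z (Sum.inl v) = 1)

/-! ### The flow formulation -/

variable {n : ℕ} {Q : Type*}

open scoped Classical in
/-- The coefficients of the flow formulation that belongs to a branching program whose states in
`accept s` are those at which the edge `s` holds. The additional variables are the node flows,
indexed by `Fin (n + 1) × Q`, and the arc flows, indexed by `Fin n × Q × Bool`. The rows are, in
this order: the flow entering layer `0`, the flow leaving and the flow entering each node, and the
expressions of the node and of the edge coordinates of `ℝ^{V ∪ S}` through the flow. -/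
noncomputable def flowMatrix (H : SignedHypergraph V) (e : V ≃ Fin n) (P : BranchingProgram n Q)
    (accept : {s // s ∈ H.edges} → Set Q) :
    Q ⊕ (Fin n × Q) ⊕ (Fin n × Q) ⊕ V ⊕ {s // s ∈ H.edges} →
      H.Coord ⊕ ((Fin (n + 1) × Q) ⊕ (Fin n × Q × Bool)) → ℝ
  | .inl q => Sum.elim (fun _ => 0)
      (Sum.elim (fun z => if z.1 = 0 ∧ z.2 = q then 1 else 0) fun _ => 0)
  | .inr (.inl (i, q)) => Sum.elim (fun _ => 0)
      (Sum.elim (fun z => if z.1 = i.castSucc ∧ z.2 = q then 1 else 0)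
        fun z => if z.1 = i ∧ z.2.1 = q then -1 else 0)
  | .inr (.inr (.inl (i, q))) => Sum.elim (fun _ => 0)
      (Sum.elim (fun z => if z.1 = i.succ ∧ z.2 = q then 1 else 0)
        fun z => if z.1 = i ∧ P.step i z.2.1 z.2.2 = q then -1 else 0)
  | .inr (.inr (.inr (.inl v))) => Sum.elim (fun c => if c = Sum.inl v then 1 else 0)
      (Sum.elim (fun _ => 0) fun z => if z.1 = e v ∧ z.2.2 = true then -1 else 0)
  | .inr (.inr (.inr (.inr s))) => Sum.elim (fun c => if c = Sum.inr s then 1 else 0)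
      (Sum.elim (fun z => if z.1 = Fin.last n ∧ z.2 ∈ accept s then -1 else 0) fun _ => 0)

open scoped Classical in
/-- The right-hand side of the flow formulation. -/
noncomputable def flowRhs (H : SignedHypergraph V) (P : BranchingProgram n Q) :
    Q ⊕ (Fin n × Q) ⊕ (Fin n × Q) ⊕ V ⊕ {s // s ∈ H.edges} → ℝ
  | .inl q => if q = P.start then 1 else 0
  | .inr _ => 0

theorem flowMatrix_mem (H : SignedHypergraph V) (e : V ≃ Fin n) (P : BranchingProgram n Q)
    (accept : {s // s ∈ H.edges} → Set Q) (i j) :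
    H.flowMatrix e P accept i j ∈ ({0, 1, -1} : Set ℝ) := by
  rcases i with q | ⟨i, q⟩ | ⟨i, q⟩ | v | s <;> rcases j with c | z | z <;>
    simp only [flowMatrix, Sum.elim_inl, Sum.elim_inr] <;> (try split_ifs) <;> simp

theorem flowRhs_mem (H : SignedHypergraph V) (P : BranchingProgram n Q) (i) :
    H.flowRhs P i ∈ ({0, 1, -1} : Set ℝ) := by
  rcases i with q | i <;> simp only [flowRhs] <;> (try split_ifs) <;> simp

open scoped Classical in
/-- The rows of the flow formulation, written out. -/
theorem flowMatrix_solution_iff [Fintype V] [Fintype Q] (H : SignedHypergraph V) (e : V ≃ Fin n)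
    (P : BranchingProgram n Q) (accept : {s // s ∈ H.edges} → Set Q) (x : H.Coord → ℝ)
    (y : (Fin (n + 1) × Q) ⊕ (Fin n × Q × Bool) → ℝ) :
    ((∀ j, 0 ≤ y j) ∧
      ∀ i, ∑ j, H.flowMatrix e P accept i j * Sum.elim x y j = H.flowRhs P i) ↔
    P.IsFlow (fun k q => y (Sum.inl (k, q))) (fun i q b => y (Sum.inr (i, q, b))) ∧
      (∀ v, x (Sum.inl v) = ∑ q, y (Sum.inr (e v, q, true))) ∧
      ∀ s, x (Sum.inr s) = ∑ q, if q ∈ accept s then y (Sum.inl (Fin.last n, q)) else 0 := by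
  have h0 : ∀ q, ∑ j, H.flowMatrix e P accept (.inl q) j * Sum.elim x y j = y (.inl (0, q)) := by
    intro q
    simp [flowMatrix, Fintype.sum_sum_type, Fintype.sum_prod_type, ite_and]
  have h1 : ∀ i q, ∑ j, H.flowMatrix e P accept (.inr (.inl (i, q))) j * Sum.elim x y j =
      y (.inl (i.castSucc, q)) - ∑ b, y (.inr (i, q, b)) := by
    intro i q
    simp [flowMatrix, Fintype.sum_sum_type, Fintype.sum_prod_type, ite_and, Finset.sum_add_distrib]
    ring
  have h2 : ∀ i q, ∑ j, H.flowMatrix e P accept (.inr (.inr (.inl (i, q)))) j * Sum.elim x y j =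
      y (.inl (i.succ, q)) - ∑ q', ∑ b, if P.step i q' b = q then y (.inr (i, q', b)) else 0 := by
    intro i q
    simp [flowMatrix, Fintype.sum_sum_type, Fintype.sum_prod_type, ite_and, sub_eq_add_neg,
      ← Finset.sum_neg_distrib, neg_ite, neg_add_rev]
    exact Finset.sum_congr rfl fun _ _ => add_comm _ _
  have h3 : ∀ v, ∑ j, H.flowMatrix e P accept (.inr (.inr (.inr (.inl v)))) j * Sum.elim x y j =
      x (.inl v) - ∑ q, y (.inr (e v, q, true)) := by
    intro v
    simp [flowMatrix, Fintype.sum_sum_type, Fintype.sum_prod_type, ite_and, sub_eq_add_neg,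
      ← Finset.sum_neg_distrib]
  have h4 : ∀ s, ∑ j, H.flowMatrix e P accept (.inr (.inr (.inr (.inr s)))) j * Sum.elim x y j =
      x (.inr s) - ∑ q, if q ∈ accept s then y (.inl (Fin.last n, q)) else 0 := by
    intro s
    simp [flowMatrix, Fintype.sum_sum_type, Fintype.sum_prod_type, ite_and, sub_eq_add_neg,
      ← Finset.sum_neg_distrib, neg_ite]
  constructor
  · rintro ⟨hy, hE⟩
    refine ⟨⟨fun k q => hy _, fun i q b => hy _, fun q => ?_, fun i q => ?_, fun i q => ?_⟩,
      fun v => ?_, fun s => ?_⟩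
    · exact (h0 q).symm.trans (hE (.inl q))
    · exact sub_eq_zero.1 ((h1 i q).symm.trans (hE _))
    · exact sub_eq_zero.1 ((h2 i q).symm.trans (hE _))
    · exact sub_eq_zero.1 ((h3 v).symm.trans (hE _))
    · exact sub_eq_zero.1 ((h4 s).symm.trans (hE _))
  · rintro ⟨hf, hv, hs⟩
    refine ⟨?_, ?_⟩
    · rintro (⟨k, q⟩ | ⟨i, q, b⟩)
      exacts [hf.node_nonneg k q, hf.arc_nonneg i q b]
    · rintro (q | ⟨i, q⟩ | ⟨i, q⟩ | v | s)
      · exact (h0 q).trans (hf.start q)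
      · exact (h1 i q).trans (sub_eq_zero.2 (hf.out i q))
      · exact (h2 i q).trans (sub_eq_zero.2 (hf.into i q))
      · exact (h3 v).trans (sub_eq_zero.2 (hv v))
      · exact (h4 s).trans (sub_eq_zero.2 (hs s))

/-- If the final state of a branching program determines which edges hold, then the unit flows
through the program are an extended formulation of the pseudo-Boolean polytope. -/
theorem exists_extendedFormulation_of_program [Fintype V] [Fintype Q] (H : SignedHypergraph V)
    (e : V ≃ Fin n) (P : BranchingProgram n Q) (accept : {s // s ∈ H.edges} → Set Q)
    (hacc : ∀ (s : {s // s ∈ H.edges}) (x : V → Bool),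
      s.1.Holds x ↔ P.run (x ∘ e.symm) (Fin.last n) ∈ accept s) :
    ∃ L : LiftedSystem H.Coord, L.IsExtendedFormulation H.PBP ∧ L.HasUnitData ∧
      L.q = (n + 1) * Fintype.card Q + n * (Fintype.card Q * 2) ∧
      L.m = 2 * (Fintype.card Q + (n * Fintype.card Q + (n * Fintype.card Q +
        (Fintype.card V + H.edges.card)))) +
          ((n + 1) * Fintype.card Q + n * (Fintype.card Q * 2)) := by
  classical
  obtain ⟨L, hq, hm, hunit, hL⟩ := LiftedSystem.exists_of_standardForm
    (H.flowMatrix e P accept) (H.flowRhs P) (H.flowMatrix_mem e P accept) (H.flowRhs_mem P)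
  refine ⟨L, ?_, hunit, by simpa using hq, by simpa using hm⟩
  unfold LiftedSystem.IsExtendedFormulation
  simp only [hL, flowMatrix_solution_iff]
  refine Set.Subset.antisymm ?_ (convexHull_min ?_ ?_)
  -- a solution is the average of the vertices on the random word of its flow
  · rintro z ⟨y, hf, hv, hs⟩
    obtain ⟨Ω, _, w, X, hw, hw1, hX, hg⟩ := hf.exists_distribution
    have hz : z = ∑ ω, w ω • H.vertex (X ω ∘ e) := by
      funext c
      rw [Finset.sum_apply]
      rcases c with v | s
      · rw [hv, ← hX]
        simp [vertex]
      · rw [hs]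
        simp only [← hg]
        have : ∀ q, (if q ∈ accept s then
            ∑ ω, (if P.run (X ω) (Fin.last n) = q then w ω else 0) else 0) =
            ∑ ω, if P.run (X ω) (Fin.last n) = q then (if q ∈ accept s then w ω else 0) else 0 := by
          intro q
          split_ifs <;> simp
        rw [Finset.sum_congr rfl fun q _ => this q, Finset.sum_comm]
        refine Finset.sum_congr rfl fun ω _ => ?_
        have hX' : (X ω ∘ e) ∘ e.symm = X ω := by ext; simp
        simp [vertex, hacc, hX']
    rw [hz]
    exact (convex_convexHull ℝ _).sum_mem (fun ω _ => hw ω) hw1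
      fun ω _ => subset_convexHull ℝ _ (H.vertex_mem_PBS _)
  · intro z hz
    obtain ⟨x, rfl⟩ := H.exists_eq_vertex hz
    refine ⟨Sum.elim (fun c => if P.run (x ∘ e.symm) c.1 = c.2 then 1 else 0)
      (fun c => if P.run (x ∘ e.symm) c.1.castSucc = c.2.1 ∧ (x ∘ e.symm) c.1 = c.2.2 then 1 else 0),
      P.isFlow_run (x ∘ e.symm), fun v => ?_, fun s => ?_⟩
    · simp [vertex, ite_and]
    · simp only [vertex, Sum.elim_inl, Sum.elim_inr, hacc]
      rw [Finset.sum_eq_single (P.run (x ∘ e.symm) (Fin.last n))]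
      · simp
      · intro q _ hq
        simp [hq.symm]
      · simp
  · simp only [← flowMatrix_solution_iff]
    rintro z₁ ⟨y₁, hy₁, h₁⟩ z₂ ⟨y₂, hy₂, h₂⟩ a b ha hb hab
    refine ⟨a • y₁ + b • y₂, fun j => ?_, fun i => ?_⟩
    · exact add_nonneg (mul_nonneg ha (hy₁ j)) (mul_nonneg hb (hy₂ j))
    · have hcomb : ∀ j, Sum.elim (a • z₁ + b • z₂) (a • y₁ + b • y₂) j =
          a * Sum.elim z₁ y₁ j + b * Sum.elim z₂ y₂ j := by
        rintro (j | j) <;> simp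
      simp only [hcomb, mul_add, Finset.sum_add_distrib, mul_left_comm _ a, mul_left_comm _ b,
        ← Finset.mul_sum, h₁, h₂]
      rw [← add_mul, hab, one_mul]

end SignedHypergraph

/-! ### Two families of edges -/

namespace SignedHypergraph

variable {V : Type u}

/-- The common size bound from which both asymptotic statements follow; edges may be absent. -/
theorem exists_extendedFormulation_of_twoFamilies [Fintype V] (H : SignedHypergraph V)
    {k₁ k₂ : ℕ} (hH : H.TwoFamilies k₁ k₂) :
    ∃ L : LiftedSystem H.Coord, L.IsExtendedFormulation H.PBP ∧ L.HasUnitData ∧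
      L.numVars ≤ 9 * (2 ^ max k₁ k₂ * (H.edges.card + 1) * (Fintype.card V + 1)) ∧
      L.numIneqs ≤ 9 * (2 ^ max k₁ k₂ * (H.edges.card + 1) * (Fintype.card V + 1)) := by
  classical
  obtain ⟨S₁, S₂, U, hS, hS₁, hU, hS₂⟩ := hH
  let n := Fintype.card V
  let e : V ≃ Fin n := Fintype.equivFin V
  -- the points at which some edge of the first family takes the value `1`
  let T : Finset (V → Bool) := (H.edges.filter (· ∈ S₁)).biUnion fun s =>
    Finset.univ.filter fun x => s.Holds x
  have hT : T.card ≤ H.edges.card * 2 ^ k₁ := by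
    refine (Finset.card_biUnion_le_card_mul _ _ (2 ^ k₁) fun s hs => ?_).trans
      (Nat.mul_le_mul_right _ (Finset.card_filter_le _ _))
    exact s.card_holds_le (hS₁ s (Finset.mem_filter.1 hs).2)
  obtain ⟨P, hP⟩ := BranchingProgram.exists_run_eq
    (T.map (e.arrowCongr (Equiv.refl Bool)).toEmbedding) (U.map e.toEmbedding)
  have hmem : ∀ x : V → Bool,
      x ∘ e.symm ∈ T.map (e.arrowCongr (Equiv.refl Bool)).toEmbedding ↔ x ∈ T := by
    intro x
    exact Finset.mem_map' (e.arrowCongr (Equiv.refl Bool)).toEmbedding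
  have hrun : ∀ s ∈ H.edges, ∀ x y : V → Bool, s.Holds x →
      P.run (x ∘ e.symm) (Fin.last n) = P.run (y ∘ e.symm) (Fin.last n) → s.Holds y := by
    intro s hs x y hx hxy
    rcases hP (x ∘ e.symm) with ⟨t, ht, htx⟩ | ⟨u, hu, hxT, hux⟩ <;>
      rcases hP (y ∘ e.symm) with ⟨t', ht', hty⟩ | ⟨u', hu', hyT, huy⟩
    · have htt : t = t' := Sum.inr_injective (ht.symm.trans (hxy.trans ht'))
      have : x ∘ e.symm = y ∘ e.symm := by rw [← htx, ← hty, htt]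
      rwa [← e.symm.surjective.injective_comp_right this]
    · exact absurd (ht.symm.trans (hxy.trans hu')) (by simp)
    · exact absurd (hu.symm.trans (hxy.trans ht')) (by simp)
    · have huu : u = u' := Sum.inl_injective (hu.symm.trans (hxy.trans hu'))
      have hs' : s ∈ S₁ ∪ S₂ := hS ▸ hs
      rcases hs' with h₁ | h₂
      · refine absurd ((hmem x).2 ?_) hxT
        exact Finset.mem_biUnion.2 ⟨s, Finset.mem_filter.2 ⟨hs, h₁⟩,
          Finset.mem_filter.2 ⟨Finset.mem_univ _, hx⟩⟩
      · refine (SignedEdge.holds_congr fun v hv => ?_).1 hx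
        have hv' : e v ∈ U.map e.toEmbedding := Finset.mem_map_of_mem _ (hS₂ s h₂ hv)
        have h := (hux ⟨e v, hv'⟩).symm.trans ((congrFun huu _).trans (huy ⟨e v, hv'⟩))
        simpa using h
  obtain ⟨L, hL, hunit, hq, hm⟩ := H.exists_extendedFormulation_of_program e P
    (fun s => {q | ∃ x : V → Bool, s.1.Holds x ∧ P.run (x ∘ e.symm) (Fin.last n) = q})
    (fun s x => ⟨fun hx => ⟨x, hx, rfl⟩, fun ⟨y, hy, hyx⟩ => hrun s s.2 y x hy hyx⟩)
  have hW : Fintype.card (({i // i ∈ U.map e.toEmbedding} → Bool) ⊕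
      {t // t ∈ T.map (e.arrowCongr (Equiv.refl Bool)).toEmbedding}) ≤
      2 ^ max k₁ k₂ * (H.edges.card + 1) := by
    rw [Fintype.card_sum, Fintype.card_fun, Fintype.card_bool, Fintype.card_coe, Fintype.card_coe,
      Finset.card_map, Finset.card_map, hU]
    have h₁ : 2 ^ k₁ ≤ 2 ^ max k₁ k₂ := Nat.pow_le_pow_right two_pos (le_max_left _ _)
    have h₂ : 2 ^ k₂ ≤ 2 ^ max k₁ k₂ := Nat.pow_le_pow_right two_pos (le_max_right _ _)
    have h₃ := hT.trans (Nat.mul_le_mul_left H.edges.card h₁)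
    rw [mul_add, mul_one, mul_comm]
    lia
  have hpos : H.edges.card + 1 ≤ 2 ^ max k₁ k₂ * (H.edges.card + 1) :=
    Nat.le_mul_of_pos_left _ (by positivity)
  have hcard : Fintype.card H.Coord = n + H.edges.card := by simp [n]
  refine ⟨L, hL, hunit, ?_, ?_⟩
  · rw [LiftedSystem.numVars, hcard, hq]
    change _ ≤ 9 * (_ * (n + 1))
    nlinarith [Nat.mul_le_mul_left n hW, Nat.mul_le_mul_left n hpos]
  · rw [LiftedSystem.numIneqs, hm]
    change 2 * (_ + (_ + (_ + (n + _)))) + _ ≤ 9 * (_ * (n + 1))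
    nlinarith [Nat.mul_le_mul_left n hW, Nat.mul_le_mul_left n hpos]

end SignedHypergraph

/-- The detour through `1 + p ^ 2`, which is at least `1` and at least `p`, allows rounding up the
exponent also when `p < 1`. -/
theorem two_pow_le_one_add_sq_pow {c p : ℝ} (hc : 0 ≤ c) (hp : 0 < p) {k : ℕ}
    (hk : (k : ℝ) ≤ c * Real.log p) : (2 : ℝ) ^ k ≤ (1 + p ^ 2) ^ ⌈c⌉₊ := by
  have hp1 : p ≤ 1 + p ^ 2 := by nlinarith [sq_nonneg (p - 1)]
  have h1 : (1 : ℝ) ≤ 1 + p ^ 2 := by nlinarith [sq_nonneg p]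
  calc (2 : ℝ) ^ k ≤ Real.exp 1 ^ k := by
        gcongr
        linarith [Real.add_one_le_exp 1]
    _ = Real.exp k := by rw [← Real.exp_nat_mul, mul_one]
    _ ≤ Real.exp (⌈c⌉₊ * Real.log (1 + p ^ 2)) := by
        refine Real.exp_le_exp.2 (hk.trans ?_)
        calc c * Real.log p ≤ c * Real.log (1 + p ^ 2) := by gcongr
          _ ≤ ⌈c⌉₊ * Real.log (1 + p ^ 2) :=
            mul_le_mul_of_nonneg_right (Nat.le_ceil c) (Real.log_nonneg h1)
    _ = (1 + p ^ 2) ^ ⌈c⌉₊ := by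
        rw [Real.exp_nat_mul, Real.exp_log (by positivity)]

theorem mainTheorem11 :
    (∃ C : ℕ, ∀ (V : Type u) [Fintype V] (H : SignedHypergraph V) (k₁ k₂ : ℕ),
      H.edges.Nonempty → H.TwoFamilies k₁ k₂ →
      ∃ L : LiftedSystem H.Coord,
        L.IsExtendedFormulation H.PBP ∧
        L.numVars ≤ C * (2 ^ max k₁ k₂ * H.edges.card * Fintype.card V) ∧
        L.numIneqs ≤ C * (2 ^ max k₁ k₂ * H.edges.card * Fintype.card V) ∧
        L.HasUnitData) ∧
    (∀ (c : ℝ) (p : MvPolynomial (Fin 2) ℝ), 0 ≤ c →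
      ∃ r : MvPolynomial (Fin 2) ℝ,
        ∀ (V : Type u) [Fintype V] (H : SignedHypergraph V) (k₁ k₂ : ℕ),
          H.TwoFamilies k₁ k₂ →
          0 < MvPolynomial.eval ![(Fintype.card V : ℝ), (H.edges.card : ℝ)] p →
          ((max k₁ k₂ : ℕ) : ℝ) ≤
            c * Real.log (MvPolynomial.eval ![(Fintype.card V : ℝ), (H.edges.card : ℝ)] p) →
          ∃ L : LiftedSystem H.Coord,
            L.IsExtendedFormulation H.PBP ∧
            (L.numVars : ℝ) ≤
              MvPolynomial.eval ![(Fintype.card V : ℝ), (H.edges.card : ℝ)] r ∧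
            (L.numIneqs : ℝ) ≤
              MvPolynomial.eval ![(Fintype.card V : ℝ), (H.edges.card : ℝ)] r ∧
            L.HasUnitData) := by
  refine ⟨⟨36, ?_⟩, ?_⟩
  -- a nonempty edge set gives `|S| + 1 ≤ 2 |S|` and `|V| + 1 ≤ 2 |V|`, hence the factor `4 * 9`
  · intro V _ H k₁ k₂ hne hH
    obtain ⟨L, hL, hunit, hv, hi⟩ := H.exists_extendedFormulation_of_twoFamilies hH
    obtain ⟨s, hs⟩ := hne
    have hm : 1 ≤ H.edges.card := Finset.card_pos.2 ⟨s, hs⟩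
    have hn : 2 ≤ Fintype.card V := s.two_le_card.trans (Finset.card_le_univ _)
    have hbound : 9 * (2 ^ max k₁ k₂ * (H.edges.card + 1) * (Fintype.card V + 1)) ≤
        36 * (2 ^ max k₁ k₂ * H.edges.card * Fintype.card V) :=
      calc _ ≤ 9 * (2 ^ max k₁ k₂ * (2 * H.edges.card) * (2 * Fintype.card V)) := by
            gcongr <;> lia
        _ = _ := by ring
    exact ⟨L, hL, hv.trans hbound, hi.trans hbound, hunit⟩
  · intro c p hc
    refine ⟨MvPolynomial.C 9 * ((1 + p ^ 2) ^ ⌈c⌉₊ * (MvPolynomial.X 1 + 1) *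
      (MvPolynomial.X 0 + 1)), fun V _ H k₁ k₂ hH hp hk => ?_⟩
    obtain ⟨L, hL, hunit, hv, hi⟩ := H.exists_extendedFormulation_of_twoFamilies hH
    have hbound : ((9 * (2 ^ max k₁ k₂ * (H.edges.card + 1) * (Fintype.card V + 1)) : ℕ) : ℝ) ≤
        MvPolynomial.eval ![(Fintype.card V : ℝ), (H.edges.card : ℝ)]
          (MvPolynomial.C 9 * ((1 + p ^ 2) ^ ⌈c⌉₊ * (MvPolynomial.X 1 + 1) *
            (MvPolynomial.X 0 + 1))) := by
      have h2 := two_pow_le_one_add_sq_pow hc hp hk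
      simp only [map_mul, map_pow, map_add, map_one, MvPolynomial.eval_C, MvPolynomial.eval_X,
        Matrix.cons_val_zero, Matrix.cons_val_one]
      push_cast
      gcongr
    exact ⟨L, hL, (Nat.cast_le.2 hv).trans hbound, (Nat.cast_le.2 hi).trans hbound, hunit⟩
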